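/- Consider the following game of Cops and Robber with a robber of speed $t$ ($t$ a positive integer) on a finite simple connected graph $G$. First the cops are placed on vertices of their choice (several cops may share a vertex); then the robber, seeing them, chooses a vertex. The two sides then move alternately, the cops first, with perfect information. In the cops' move each cop stays or goes to an adjacent vertex; in the robber's move she stays or follows a path of length at most $t$ from her current vertex that contains no vertex occupied by a cop. The cops win if at some time a cop is on the robber's vertex; otherwise the robber wins. The cop number $c_t(G)$ is the minimum number of cops for which the cops have a winning strategy. Theorem. Let $t$ be a fixed positive integer. (a) If $t\ge 2$, then there is a constant $c>0$ (which may depend on $t$) such that for every integer $n\ge 1$ there exists a connected graph $G$ with exactly $n$ vertices and $c_t(G)\ge c\,n^{2/3}$. (b) If $t\ge 4$, then there is a constant $c>0$ (which may depend on $t$) such that for every integer $n\ge 1$ there exists a connected graph $G$ with exactly $n$ vertices and $c_t(G)\ge c\,n^{4/5}$. -/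

import Mathlib

namespace FastRobber

/-- A (deterministic, history-dependent) strategy for `k` cops on `G`. For a list `h` of the
robber's positions so far, the most recent one first, `pos h i` is the vertex that the `i`-th cop
occupies after the cops have reacted to `h`; in particular `pos []` is the initial placement, which
is arbitrary (several cops may share a vertex). In every move each cop stays where it is or goes to
an adjacent vertex. -/
structure CopStrategy {V : Type*} (G : SimpleGraph V) (k : ℕ) where
  pos : List V → Fin k → V
  legal : ∀ (r : V) (h : List V) (i : Fin k),
    pos (r :: h) i = pos h i ∨ G.Adj (pos h i) (pos (r :: h) i)

/-- A legal move of a robber of speed `t` from `u` to `v` while the cops occupy the vertices `C i`: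
a path of length at most `t` (length `0` means that she stays) with no vertex occupied by a cop. -/
def RobberMove {V : Type*} (G : SimpleGraph V) (t : ℕ) {k : ℕ} (C : Fin k → V) (u v : V) : Prop :=
  ∃ p : G.Walk u v, p.IsPath ∧ p.length ≤ t ∧ ∀ x ∈ p.support, ∀ i, C i ≠ x

/-- The list `[ρ (j - 1), …, ρ 1, ρ 0]` of the first `j` positions of the robber, the most recent
one first. -/
def history {V : Type*} (ρ : ℕ → V) : ℕ → List V
  | 0 => []
  | j + 1 => ρ j :: history ρ j

/-- The positions of the cops after their `j`-th move, when they play the strategy `σ` and the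
robber's successive positions are `ρ 0, ρ 1, …`; for `j = 0` this is the initial placement. -/
def copsAt {V : Type*} {G : SimpleGraph V} {k : ℕ} (σ : CopStrategy G k) (ρ : ℕ → V) (j : ℕ) :
    Fin k → V :=
  σ.pos (history ρ j)

/-- The robber is caught while she is at her position `ρ j`: a cop is already there (which, for a
robber who plays by the rules, can happen only if `j = 0` and she started at an occupied vertex), or
a cop steps into `ρ j` in the next move of the cops. -/
def CaughtAt {V : Type*} {G : SimpleGraph V} {k : ℕ} (σ : CopStrategy G k) (ρ : ℕ → V) (j : ℕ) :
    Prop :=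
  ∃ i, copsAt σ ρ j i = ρ j ∨ copsAt σ ρ (j + 1) i = ρ j

/-- The sequence `ρ` of positions of the robber is a legal way to play against `σ`: the initial
position `ρ 0` is arbitrary, and as long as she has not been caught she answers the `(j + 1)`-st
move of the cops with a legal move from `ρ j` to `ρ (j + 1)`. -/
def LegalPlay {V : Type*} {G : SimpleGraph V} (t : ℕ) {k : ℕ} (σ : CopStrategy G k)
    (ρ : ℕ → V) : Prop :=
  ∀ j, (∀ m ≤ j, ¬ CaughtAt σ ρ m) → RobberMove G t (copsAt σ ρ (j + 1)) (ρ j) (ρ (j + 1))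

/-- `k` cops can win on `G` against a robber of speed `t`: they have a strategy against which the
robber is eventually caught, whatever she does. -/
def CopsWin {V : Type*} (G : SimpleGraph V) (t k : ℕ) : Prop :=
  ∃ σ : CopStrategy G k, ∀ ρ : ℕ → V, LegalPlay t σ ρ → ∃ j, CaughtAt σ ρ j

/-- On a finite graph some number of cops wins: put one on every vertex. -/
theorem exists_copsWin {V : Type*} [Finite V] (G : SimpleGraph V) (t : ℕ) :
    ∃ k, CopsWin G t k := by
  refine ⟨Nat.card V, ⟨fun _ => (Finite.equivFin V).symm, fun _ _ _ => Or.inl rfl⟩, ?_⟩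
  intro ρ _
  exact ⟨0, Finite.equivFin V (ρ 0), Or.inl (by simp [copsAt])⟩

/-- The cop number of a finite graph `G` when the robber has speed `t`: the minimum number of cops
that can win. -/
noncomputable def copNumber {V : Type*} [Finite V] (G : SimpleGraph V) (t : ℕ) : ℕ :=
  sInf {k : ℕ | CopsWin G t k}

end FastRobber

/-! The robber plays on a `d`-regular graph in which nonbacktracking walks of length at most `t + 1`
are determined by their ends, so about `d ^ t` walks of length `t` lead from her vertex to distinct
vertices. She keeps the invariant `Safe`: for each `j ≤ t`, at most `d ^ j / M` cops are within
distance `j + 1`. After the cops move, at most `d ^ j / M` are within distance `j`. Each of these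
can stop at most one walk at time `j`, so a positive proportion of the walks stays free
(`card_blockedWalks_le`). Near any one cop, only `O(d ^ j)` walks avoiding that cop end within
distance `j + 1` (`card_walksNear_le`), one factor `d` below the size of the ball. Averaging over
the cops, some free walk ends at a safe vertex provided that `k` is at most a small constant times
`d ^ t` (`exists_safe_walk`).

With about `d ^ (t + 1)` vertices this gives the exponent `t / (t + 1)`. For `t = 2` and `t = 4`
such graphs are the incidence graphs of affine parts of the symplectic quadrangle and the split
Cayley hexagon over `ZMod q`; the absence of short polygons is checked in coordinates. Larger speeds
only help the robber, and Bertrand's postulate together with cloning of vertices reaches every `n`.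
-/

namespace FastRobber
open Finset Function

/-! ### Counting nonbacktracking walks -/

section Walks

variable {V : Type*} {G : SimpleGraph V}

/-- The first `s` steps of `x` form a nonbacktracking walk in `G`. -/
def Nonbacktracking (G : SimpleGraph V) (x : ℕ → V) (s : ℕ) : Prop :=
  (∀ i < s, G.Adj (x i) (x (i + 1))) ∧ ∀ i, i + 2 ≤ s → x i ≠ x (i + 2)

/-- Two nonbacktracking walks with the same ends and the same length, at most `m`, have the same
last step. -/
def UniqueWalks (G : SimpleGraph V) (m : ℕ) : Prop :=
  ∀ s < m, ∀ x y : ℕ → V, Nonbacktracking G x (s + 1) → Nonbacktracking G y (s + 1) →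
    x 0 = y 0 → x (s + 1) = y (s + 1) → x s = y s

theorem UniqueWalks.comap {W : Type*} {H : SimpleGraph W} {m : ℕ} (hG : UniqueWalks G m)
    (e : W → V) (he : Injective e) (h : ∀ u v, H.Adj u v → G.Adj (e u) (e v)) :
    UniqueWalks H m := by
  intro s hs x y hx hy h0 h1
  refine he (hG s hs (e ∘ x) (e ∘ y) ⟨fun i hi => h _ _ (hx.1 i hi), fun i hi h' => ?_⟩
    ⟨fun i hi => h _ _ (hy.1 i hi), fun i hi h' => ?_⟩ (congrArg e h0) (congrArg e h1))
  · exact hx.2 i hi (he h')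
  · exact hy.2 i hi (he h')

variable [Fintype V]

open scoped Classical in
/-- The nonbacktracking walks of length `s` from `r`, as functions that are constantly `r` after
time `s`. -/
noncomputable def nbWalks (G : SimpleGraph V) (r : V) : ℕ → Finset (ℕ → V)
  | 0 => {fun _ => r}
  | s + 1 => (nbWalks G r s).biUnion fun f =>
      (univ.filter fun v => G.Adj (f s) v ∧ v ≠ f (s - 1)).image fun v => update f (s + 1) v

variable {r : V}

theorem eq_of_mem_nbWalks {s : ℕ} {f : ℕ → V} (hf : f ∈ nbWalks G r s) :
    f 0 = r ∧ ∀ i, s < i → f i = r := by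
  induction s generalizing f with
  | zero => simp only [nbWalks, mem_singleton] at hf; simp [hf]
  | succ s ih =>
    simp only [nbWalks, mem_biUnion, mem_image] at hf
    obtain ⟨g, hg, v, -, rfl⟩ := hf
    refine ⟨by simp [(ih hg).1], fun i hi => ?_⟩
    rw [update_of_ne (by omega)]
    exact (ih hg).2 i (by omega)

/-- Since walks are padded with `r`, resetting entry `s + 1` to `r` is the same as deleting the last
step. -/
theorem mem_nbWalks_succ {s : ℕ} {g : ℕ → V} :
    g ∈ nbWalks G r (s + 1) ↔
      update g (s + 1) r ∈ nbWalks G r s ∧ G.Adj (g s) (g (s + 1)) ∧ g (s + 1) ≠ g (s - 1) := by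
  constructor
  · intro hg
    simp only [nbWalks, mem_biUnion, mem_image, mem_filter, mem_univ, true_and] at hg
    obtain ⟨f, hf, v, ⟨h1, h2⟩, rfl⟩ := hg
    have : update (update f (s + 1) v) (s + 1) r = f := by
      rw [update_idem, ← (eq_of_mem_nbWalks hf).2 (s + 1) (by omega), update_eq_self]
    rw [this, update_of_ne (by omega), update_self, update_of_ne (by omega)]
    exact ⟨hf, h1, h2⟩
  · rintro ⟨h1, h2, h3⟩
    simp only [nbWalks, mem_biUnion, mem_image, mem_filter, mem_univ, true_and]
    refine ⟨_, h1, g (s + 1), ⟨?_, ?_⟩, by simp⟩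
    · rwa [update_of_ne (by omega)]
    · rwa [update_of_ne (by omega)]

theorem nonbacktracking_of_mem_nbWalks {s : ℕ} {f : ℕ → V} (hf : f ∈ nbWalks G r s) :
    Nonbacktracking G f s := by
  induction s generalizing f with
  | zero => exact ⟨fun i hi => by omega, fun i hi => by omega⟩
  | succ s ih =>
    obtain ⟨h1, h2, h3⟩ := mem_nbWalks_succ.1 hf
    obtain ⟨h4, h5⟩ := ih h1
    constructor
    · intro i hi
      rcases Nat.lt_succ_iff_lt_or_eq.1 hi with hi' | rfl
      · have := h4 i hi'
        rwa [update_of_ne (by omega), update_of_ne (by omega)] at this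
      · exact h2
    · intro i hi
      rcases Nat.le_succ_iff.1 hi with hi' | hi'
      · have := h5 i hi'
        rwa [update_of_ne (by omega), update_of_ne (by omega)] at this
      · obtain rfl : s = i + 1 := by omega
        exact h3.symm

/-- The common end forces a common last step; going backwards, the whole walk is recovered. -/
theorem nbWalks_injOn {m : ℕ} (hG : UniqueWalks G m) {s : ℕ} (hs : s ≤ m) {f g : ℕ → V}
    (hf : f ∈ nbWalks G r s) (hg : g ∈ nbWalks G r s) (h : f s = g s) : f = g := by
  induction s generalizing f g with
  | zero => simp only [nbWalks, mem_singleton] at hf hg; rw [hf, hg]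
  | succ s ih =>
    have h1 := hG s (by omega) f g (nonbacktracking_of_mem_nbWalks hf)
      (nonbacktracking_of_mem_nbWalks hg)
      ((eq_of_mem_nbWalks hf).1.trans (eq_of_mem_nbWalks hg).1.symm) h
    have h2 := ih (by omega) (mem_nbWalks_succ.1 hf).1 (mem_nbWalks_succ.1 hg).1
      (by rwa [update_of_ne (by omega), update_of_ne (by omega)])
    funext i
    by_cases hi : i = s + 1
    · rw [hi, h]
    · have := congrFun h2 i
      rwa [update_of_ne hi, update_of_ne hi] at this

open scoped Classical in
theorem card_filter_nbWalks_fiber {s : ℕ} {f : ℕ → V} (hf : f ∈ nbWalks G r s) :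
    ((nbWalks G r (s + 1)).filter fun g => update g (s + 1) r = f).card =
      (univ.filter fun v => G.Adj (f s) v ∧ v ≠ f (s - 1)).card := by
  refine card_bij (fun g _ => g (s + 1)) ?_ ?_ ?_
  · intro g hg
    obtain ⟨hg', rfl⟩ := mem_filter.1 hg
    obtain ⟨-, h1, h2⟩ := mem_nbWalks_succ.1 hg'
    simp only [mem_filter, mem_univ, true_and]
    rw [update_of_ne (by omega), update_of_ne (by omega)]
    exact ⟨h1, h2⟩
  · intro g hg g' hg' h
    have h1 := (mem_filter.1 hg).2.trans (mem_filter.1 hg').2.symm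
    funext i
    by_cases hi : i = s + 1
    · rw [hi, h]
    · have := congrFun h1 i
      rwa [update_of_ne hi, update_of_ne hi] at this
  · intro v hv
    obtain ⟨h1, h2⟩ := (mem_filter.1 hv).2
    have h3 : update (update f (s + 1) v) (s + 1) r = f := by
      rw [update_idem, ← (eq_of_mem_nbWalks hf).2 (s + 1) (by omega), update_eq_self]
    refine ⟨update f (s + 1) v, mem_filter.2 ⟨mem_nbWalks_succ.2 ⟨by rwa [h3], ?_, ?_⟩, h3⟩, ?_⟩
    · rwa [update_of_ne (by omega), update_self]
    · rwa [update_self, update_of_ne (by omega)]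
    · rw [update_self]

open scoped Classical in
/-- Every vertex of `G` has exactly `d` neighbours. -/
def Regular (G : SimpleGraph V) (d : ℕ) : Prop :=
  ∀ v, (univ.filter fun w => G.Adj v w).card = d

variable {d : ℕ}

theorem le_card_nbWalks (hd : Regular G d) (s : ℕ) : (d - 1) ^ s ≤ (nbWalks G r s).card := by
  classical
  induction s with
  | zero => simp [nbWalks]
  | succ s ih =>
    rw [pow_succ']
    refine (Nat.mul_le_mul_left _ ih).trans
      (mul_card_image_le_card_of_maps_to (fun g hg => (mem_nbWalks_succ.1 hg).1) _ ?_)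
    intro f hf
    rw [card_filter_nbWalks_fiber hf, ← hd (f s)]
    -- At most one neighbour is forbidden; for `s = 0` the truncated `f (s - 1)` is `f 0` itself,
    -- which forbids none.
    refine (pred_card_le_card_erase (a := f (s - 1))).trans (card_le_card fun v hv => ?_)
    simpa [and_comm] using hv

theorem two_pow_mul_card_nbWalks (hd : Regular G d) (h2 : 2 ≤ d) (s : ℕ) :
    d ^ s ≤ 2 ^ s * (nbWalks G r s).card := by
  refine le_trans ?_ (Nat.mul_le_mul_left _ (le_card_nbWalks hd s))
  rw [← mul_pow]
  exact Nat.pow_le_pow_left (by omega) _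

theorem card_le_of_mapsTo_nbWalks (hd : Regular G d) {s : ℕ} {A B : Finset (ℕ → V)}
    (hA : A ⊆ nbWalks G r (s + 1)) (hB : B ⊆ nbWalks G r s)
    (h : ∀ g ∈ A, update g (s + 1) r ∈ B) : A.card ≤ d * B.card := by
  classical
  refine card_le_mul_card_image_of_maps_to h _ fun f hf => ?_
  rw [← hd (f s)]
  calc _ ≤ ((nbWalks G r (s + 1)).filter fun g => update g (s + 1) r = f).card :=
        card_le_card (filter_subset_filter _ hA)
    _ = _ := card_filter_nbWalks_fiber (hB hf)
    _ ≤ _ := card_le_card fun v hv => by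
        simp only [mem_filter, mem_univ, true_and] at hv ⊢
        exact hv.1

open scoped Classical in
/-- The vertices at distance at most `j` from `u`. -/
noncomputable def ball (G : SimpleGraph V) (u : V) : ℕ → Finset V
  | 0 => {u}
  | j + 1 => (ball G u j).biUnion fun w => insert w (univ.filter fun v => G.Adj w v)

theorem mem_ball_succ {u v : V} {j : ℕ} :
    v ∈ ball G u (j + 1) ↔ ∃ w ∈ ball G u j, v = w ∨ G.Adj w v := by
  simp [ball]

theorem card_ball_le (hd : Regular G d) (u : V) (j : ℕ) : (ball G u j).card ≤ (d + 1) ^ j := by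
  classical
  induction j with
  | zero => simp [ball]
  | succ j ih =>
    rw [ball, pow_succ]
    refine card_biUnion_le_card_mul _ _ (d + 1) (fun w _ => ?_) |>.trans (Nat.mul_le_mul_right _ ih)
    refine (card_insert_le _ _).trans ?_
    rw [hd w]

theorem ball_subset_ball_succ {u u' : V} (h : u' = u ∨ G.Adj u u') (j : ℕ) :
    ball G u' j ⊆ ball G u (j + 1) := by
  induction j with
  | zero =>
    intro v hv
    simp only [ball, mem_singleton] at hv
    exact mem_ball_succ.2 ⟨u, by simp [ball], by rwa [hv]⟩
  | succ j ih =>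
    intro v hv
    obtain ⟨w, hw, h'⟩ := mem_ball_succ.1 hv
    exact mem_ball_succ.2 ⟨w, ih hw, h'⟩

theorem start_mem_ball {s : ℕ} {f : ℕ → V} (hf : f ∈ nbWalks G r s) : r ∈ ball G (f s) s := by
  have key : ∀ i ≤ s, f (s - i) ∈ ball G (f s) i := by
    intro i hi
    induction i with
    | zero => simp [ball]
    | succ i ih =>
      refine mem_ball_succ.2 ⟨_, ih (by omega), Or.inr ?_⟩
      have := (nonbacktracking_of_mem_nbWalks hf).1 (s - (i + 1)) (by omega)
      rw [show s - (i + 1) + 1 = s - i by omega] at this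
      exact this.symm
  have := key s le_rfl
  rwa [Nat.sub_self, (eq_of_mem_nbWalks hf).1] at this

theorem exists_walk_of_mem_nbWalks {s : ℕ} {f : ℕ → V} (hf : f ∈ nbWalks G r s) :
    ∃ p : G.Walk r (f s), p.length = s ∧ ∀ x ∈ p.support, ∃ i ≤ s, f i = x := by
  obtain ⟨hadj, -⟩ := nonbacktracking_of_mem_nbWalks hf
  have h0 := (eq_of_mem_nbWalks hf).1
  clear hf
  induction s with
  | zero =>
    refine ⟨SimpleGraph.Walk.nil.copy rfl h0.symm, by simp, fun x hx => ⟨0, le_rfl, ?_⟩⟩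
    simp at hx
    rw [h0, hx]
  | succ s ih =>
    obtain ⟨p, hp, hs⟩ := ih fun i hi => hadj i (by omega)
    refine ⟨p.concat (hadj s (by omega)), by simp [hp], fun x hx => ?_⟩
    rw [SimpleGraph.Walk.support_concat, List.mem_append,
      List.mem_singleton] at hx
    rcases hx with hx | rfl
    · obtain ⟨i, hi, h⟩ := hs x hx
      exact ⟨i, by omega, h⟩
    · exact ⟨s + 1, le_rfl, rfl⟩

open scoped Classical in
/-- The walks in `nbWalks G r s` that avoid `c` and end at distance at most `j` from `c`. -/
noncomputable def walksNear (G : SimpleGraph V) (r c : V) (s j : ℕ) : Finset (ℕ → V) :=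
  (nbWalks G r s).filter fun f => (∀ i ≤ s, f i ≠ c) ∧ f s ∈ ball G c j

theorem walksNear_zero (c : V) (s : ℕ) : walksNear G r c s 0 = ∅ := by
  classical
  refine filter_eq_empty_iff.2 fun f _ h => h.1 s le_rfl ?_
  simpa [ball] using h.2

/-- An end within distance `j + 1` of `c` is either in the `j`-ball (`A`), or has a neighbour there
that prolongs the walk (`B`), or was reached from that ball (`E`). Unique walks inject `A` and `B`
into the `j`-ball; deleting the last step reduces `E` to a shorter walk and a smaller radius. -/
theorem card_walksNear_le {t : ℕ} (hG : UniqueWalks G (t + 1)) (hd : Regular G d) (c : V)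
    {s : ℕ} (hs : s ≤ t) (j : ℕ) :
    (walksNear G r c s (j + 1)).card ≤ (2 * s + 1) * (d + 1) ^ j := by
  classical
  induction s generalizing j with
  | zero =>
    refine (card_le_card (filter_subset _ _)).trans ?_
    simpa [nbWalks] using Nat.one_le_pow _ _ (Nat.succ_pos d)
  | succ s ih =>
    set X := nbWalks G r (s + 1) with hX
    set A := X.filter fun f => f (s + 1) ∈ ball G c j with hA
    set B := X.filter fun f => ∃ w ∈ ball G c j, G.Adj (f (s + 1)) w ∧ w ≠ f s with hB
    set E := (walksNear G r c (s + 1) (j + 1)).filter fun f => f s ∈ ball G c j with hE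
    have hsub : walksNear G r c (s + 1) (j + 1) ⊆ A ∪ B ∪ E := by
      intro f hf
      obtain ⟨hfX, hfc, hfb⟩ := mem_filter.1 hf
      obtain ⟨w, hw, h⟩ := mem_ball_succ.1 hfb
      rcases h with h | h
      · exact mem_union_left _ (mem_union_left _ (mem_filter.2 ⟨hfX, h ▸ hw⟩))
      · by_cases hws : w = f s
        · exact mem_union_right _ (mem_filter.2 ⟨hf, hws ▸ hw⟩)
        · exact mem_union_left _ (mem_union_right _ (mem_filter.2 ⟨hfX, w, hw, h.symm, hws⟩))
    have hAc : A.card ≤ (d + 1) ^ j := by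
      refine le_trans (card_le_card_of_injOn (fun f => f (s + 1)) ?_ ?_) (card_ball_le hd c j)
      · intro f hf
        exact (mem_filter.1 hf).2
      · intro f hf g hg h
        exact nbWalks_injOn hG (by omega) (mem_filter.1 hf).1 (mem_filter.1 hg).1 h
    -- Here uniqueness is needed up to length `t + 1`: the walk is prolonged by one step into the
    -- ball.
    have hBc : B.card ≤ (d + 1) ^ j := by
      have hBw : ∀ f, ∃ w, f ∈ B → w ∈ ball G c j ∧ G.Adj (f (s + 1)) w ∧ w ≠ f s := by
        intro f
        by_cases hf : f ∈ B
        · obtain ⟨w, hw⟩ := (mem_filter.1 hf).2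
          exact ⟨w, fun _ => hw⟩
        · exact ⟨r, fun h => absurd h hf⟩
      choose w hw using hBw
      have hext : ∀ f ∈ B, update f (s + 2) (w f) ∈ nbWalks G r (s + 2) ∧
          update (update f (s + 2) (w f)) (s + 2) r = f := by
        intro f hf
        have h3 : update (update f (s + 2) (w f)) (s + 2) r = f := by
          rw [update_idem, ← (eq_of_mem_nbWalks (mem_filter.1 hf).1).2 (s + 2) (by omega),
            update_eq_self]
        refine ⟨mem_nbWalks_succ.2 ⟨?_, ?_, ?_⟩, h3⟩
        · rw [h3]; exact (mem_filter.1 hf).1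
        · rw [update_of_ne (by omega), update_self]; exact (hw f hf).2.1
        · rw [update_self, update_of_ne (by omega)]; exact (hw f hf).2.2
      refine le_trans (card_le_card_of_injOn w (fun f hf => (hw f hf).1) ?_) (card_ball_le hd c j)
      intro f hf g hg h
      have := nbWalks_injOn hG (by omega) (hext f hf).1 (hext g hg).1
        (by rw [update_self, update_self]; exact h)
      rw [← (hext f hf).2, this, (hext g hg).2]
    have hEc : E.card ≤ (2 * s + 1) * (d + 1) ^ j := by
      have hmap : ∀ g ∈ E, update g (s + 1) r ∈ walksNear G r c s j := by
        intro g hg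
        obtain ⟨hg1, hg2⟩ := mem_filter.1 hg
        obtain ⟨hgX, hgc, -⟩ := mem_filter.1 hg1
        refine mem_filter.2 ⟨(mem_nbWalks_succ.1 hgX).1, fun i hi => ?_, ?_⟩
        · rw [update_of_ne (by omega)]; exact hgc i (by omega)
        · rwa [update_of_ne (by omega)]
      have hle := card_le_of_mapsTo_nbWalks hd (A := E) (B := walksNear G r c s j)
        ((filter_subset _ _).trans (filter_subset _ _)) (filter_subset _ _) hmap
      -- For `j = 0` the shortened walk would end at `c`, which it avoids.
      rcases j with _ | j
      · rw [walksNear_zero] at hle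
        simp only [card_empty, mul_zero] at hle
        omega
      · calc E.card ≤ d * ((2 * s + 1) * (d + 1) ^ j) :=
              hle.trans (Nat.mul_le_mul_left _ (ih (by omega) j))
          _ ≤ (d + 1) * ((2 * s + 1) * (d + 1) ^ j) := Nat.mul_le_mul_right _ (by omega)
          _ = _ := by ring
    have := (card_le_card hsub).trans ((card_union_le _ _).trans
      (Nat.add_le_add_right (card_union_le _ _) _))
    calc _ ≤ _ := this
      _ ≤ (d + 1) ^ j + (d + 1) ^ j + (2 * s + 1) * (d + 1) ^ j := by gcongr
      _ = _ := by ring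

end Walks
end FastRobber

namespace FastRobber
open Finset Function

/-! ### The robber's strategy on a regular graph with unique short walks -/

section Game

/-- Markov's inequality by double counting: it bounds the elements of `T` that are related to more
than `a / M` cops. -/
theorem card_filter_lt_mul_le {α : Type*} {k : ℕ} (T : Finset α) (R : α → Fin k → Prop)
    [∀ f i, Decidable (R f i)] {L : ℕ} (a M : ℕ) (h : ∀ i, (T.filter fun f => R f i).card ≤ L) :
    a * (T.filter fun f => a < M * (univ.filter fun i => R f i).card).card ≤ M * (k * L) := by
  set S := T.filter fun f => a < M * (univ.filter fun i => R f i).card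
  calc a * S.card = ∑ _f ∈ S, a := by simp [mul_comm]
    _ ≤ ∑ f ∈ S, M * (univ.filter fun i => R f i).card :=
        sum_le_sum fun f hf => (mem_filter.1 hf).2.le
    _ ≤ ∑ f ∈ T, M * (univ.filter fun i => R f i).card :=
        sum_le_sum_of_subset (filter_subset _ _)
    _ = M * ∑ i : Fin k, (T.filter fun f => R f i).card := by
        rw [← mul_sum]
        congr 1
        exact sum_card_bipartiteAbove_eq_sum_card_bipartiteBelow R
    _ ≤ M * ∑ _i : Fin k, L := Nat.mul_le_mul_left _ (sum_le_sum fun i _ => h i)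
    _ = _ := by simp

variable {V : Type*} {G : SimpleGraph V} [Fintype V] {r : V} {d k t M : ℕ}

open scoped Classical in
/-- The number of cops at distance at most `j` from `v`. -/
noncomputable def copsNear (G : SimpleGraph V) (C : Fin k → V) (v : V) (j : ℕ) : ℕ :=
  (univ.filter fun i => v ∈ ball G (C i) j).card

open scoped Classical in
/-- The walks in `nbWalks G r s` that meet a cop. -/
noncomputable def blockedWalks (G : SimpleGraph V) (C : Fin k → V) (r : V) (s : ℕ) :
    Finset (ℕ → V) :=
  (nbWalks G r s).filter fun f => ∃ i, ∃ m ≤ s, f m = C i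

/-- A cop met at time `s` is within distance `s` of `r` and determines the walk up to then. So each
time step adds at most `d ^ s / M` blocked walks to the continuations of those already blocked; at
time `0` there are none because `M ≥ 2`. -/
theorem card_blockedWalks_le (hG : UniqueWalks G (t + 1)) (hd : Regular G d) (hM : 2 ≤ M)
    {C : Fin k → V} (hC : ∀ j ≤ t, M * copsNear G C r j ≤ d ^ j) {s : ℕ} (hs : s ≤ t) :
    M * (blockedWalks G C r s).card ≤ s * d ^ s := by
  classical
  induction s with
  | zero =>
    have h0 := hC 0 (Nat.zero_le _)
    have h1 : copsNear G C r 0 = 0 := by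
      by_contra h
      have := Nat.mul_le_mul hM (Nat.one_le_iff_ne_zero.2 h)
      simp only [pow_zero] at h0
      omega
    have h2 : blockedWalks G C r 0 = ∅ := by
      refine filter_eq_empty_iff.2 fun f hf => ?_
      rintro ⟨i, m, hm, h⟩
      refine (card_pos.2 ⟨i, mem_filter.2 ⟨mem_univ _, ?_⟩⟩).ne' h1
      obtain rfl : m = 0 := by omega
      rw [ball, mem_singleton, ← h, (eq_of_mem_nbWalks hf).1]
    simp [h2]
  | succ s ih =>
    set A := (blockedWalks G C r (s + 1)).filter fun f =>
      update f (s + 1) r ∈ blockedWalks G C r s with hA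
    set B := (nbWalks G r (s + 1)).filter fun f => ∃ i, f (s + 1) = C i with hB
    have hsub : blockedWalks G C r (s + 1) ⊆ A ∪ B := by
      intro f hf
      obtain ⟨hf1, i, m, hm, h⟩ := mem_filter.1 hf
      rcases Nat.le_succ_iff.1 hm with hm' | rfl
      · refine mem_union_left _ (mem_filter.2 ⟨hf, mem_filter.2
          ⟨(mem_nbWalks_succ.1 hf1).1, i, m, hm', ?_⟩⟩)
        rwa [update_of_ne (by omega)]
      · exact mem_union_right _ (mem_filter.2 ⟨hf1, i, h⟩)
    have hAc : A.card ≤ d * (blockedWalks G C r s).card :=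
      card_le_of_mapsTo_nbWalks hd ((filter_subset _ _).trans (filter_subset _ _))
        (filter_subset _ _) fun g hg => (mem_filter.1 hg).2
    have hBc : B.card ≤ copsNear G C r (s + 1) := by
      have hw : ∀ f : {f // f ∈ B}, ∃ i, f.1 (s + 1) = C i := fun f => (mem_filter.1 f.2).2
      choose w hw using hw
      rw [← card_attach]
      refine card_le_card_of_injOn w (fun f _ => mem_filter.2 ⟨mem_univ _, ?_⟩) ?_
      · rw [← hw]
        exact start_mem_ball (mem_filter.1 f.2).1
      · intro f _ g _ h
        exact Subtype.ext (nbWalks_injOn hG (by omega) (mem_filter.1 f.2).1 (mem_filter.1 g.2).1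
          (by rw [hw, hw, h]))
    calc M * (blockedWalks G C r (s + 1)).card
        ≤ M * (d * (blockedWalks G C r s).card + copsNear G C r (s + 1)) :=
          Nat.mul_le_mul_left _ ((card_le_card hsub).trans
            ((card_union_le _ _).trans (Nat.add_le_add hAc hBc)))
      _ = d * (M * (blockedWalks G C r s).card) + M * copsNear G C r (s + 1) := by ring
      _ ≤ d * (s * d ^ s) + d ^ (s + 1) :=
          Nat.add_le_add (Nat.mul_le_mul_left _ (ih (by omega))) (hC _ hs)
      _ = _ := by ring

/-- A position of the robber that is good for her when the cops are about to move: few cops are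
near. -/
def Safe (G : SimpleGraph V) (t d M : ℕ) (C : Fin k → V) (v : V) : Prop :=
  ∀ j ≤ t, M * copsNear G C v (j + 1) ≤ d ^ j

theorem Safe.ne_and_not_adj (hM : 2 ≤ M) {C : Fin k → V} {v : V} (h : Safe G t d M C v)
    (i : Fin k) : ¬ (v = C i ∨ G.Adj (C i) v) := by
  classical
  intro h'
  have h0 := h 0 (Nat.zero_le _)
  have : 1 ≤ copsNear G C v (0 + 1) :=
    card_pos.2 ⟨i, mem_filter.2 ⟨mem_univ _, mem_ball_succ.2 ⟨C i, by simp [ball], h'⟩⟩⟩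
  have := Nat.mul_le_mul hM this
  simp only [pow_zero] at h0
  omega

theorem Safe.of_cops_move {C C' : Fin k → V} {v : V} (h : Safe G t d M C v)
    (hC : ∀ i, C' i = C i ∨ G.Adj (C i) (C' i)) {j : ℕ} (hj : j ≤ t) :
    M * copsNear G C' v j ≤ d ^ j := by
  classical
  refine le_trans (Nat.mul_le_mul_left _ (card_le_card fun i hi => ?_)) (h j hj)
  simp only [mem_filter, mem_univ, true_and] at hi ⊢
  exact ball_subset_ball_succ (hC i) j hi

theorem copsNear_le (C : Fin k → V) (v : V) (j : ℕ) : copsNear G C v j ≤ k := by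
  classical
  exact (card_le_card (filter_subset _ _)).trans (by simp)

/-- There are at least `d ^ t / 2 ^ t` walks. The choice of `M` lets the cops block at most the
fraction `t / (t + 1)` of this number, and the bound on `k` makes the walks with unsafe ends fewer
than the remainder. -/
theorem exists_safe_walk (ht : 1 ≤ t) (hG : UniqueWalks G (t + 1)) (hd : Regular G d)
    (h2 : 2 ≤ d) (hM : M = 2 ^ t * (t + 1))
    (hk : (2 ^ t * t * M ^ 2 * (2 * t + 1) + 1) * k ≤ d ^ t) {C : Fin k → V}
    (hC : ∀ j ≤ t, M * copsNear G C r j ≤ d ^ j) :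
    ∃ f ∈ nbWalks G r t, f ∉ blockedWalks G C r t ∧ Safe G t d M C (f t) := by
  classical
  have hM2 : 2 ≤ M := by
    have := Nat.mul_le_mul (Nat.one_le_two_pow (n := t)) (show 2 ≤ t + 1 by omega)
    omega
  by_contra hcon
  push Not at hcon
  set T := (nbWalks G r t).filter fun f => f ∉ blockedWalks G C r t
  set bad : ℕ → Finset (ℕ → V) := fun j =>
    T.filter fun f => d ^ j < M * (univ.filter fun i => f t ∈ ball G (C i) (j + 1)).card
  have hbad : ∀ j < t, (bad j).card ≤ M * k * (2 * t + 1) * 2 ^ t := by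
    intro j hj
    have h1 : ∀ i, (T.filter fun f => f t ∈ ball G (C i) (j + 1)).card ≤
        (2 * t + 1) * (d + 1) ^ j := by
      intro i
      refine (card_le_card fun f hf => ?_).trans (card_walksNear_le (r := r) hG hd (C i) le_rfl j)
      simp only [T, blockedWalks, mem_filter] at hf
      refine mem_filter.2 ⟨hf.1.1, fun m hm h => hf.1.2 ⟨hf.1.1, i, m, hm, h⟩, hf.2⟩
    have h2 := card_filter_lt_mul_le T (fun f i => f t ∈ ball G (C i) (j + 1)) (d ^ j) M h1
    refine Nat.le_of_mul_le_mul_left (h2.trans ?_) (show 0 < d ^ j by positivity)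
    have h3 : (d + 1) ^ j ≤ 2 ^ t * d ^ j :=
      calc (d + 1) ^ j ≤ (2 * d) ^ j := Nat.pow_le_pow_left (by omega) _
        _ = 2 ^ j * d ^ j := mul_pow _ _ _
        _ ≤ _ := Nat.mul_le_mul_right _ (Nat.pow_le_pow_right (by omega) hj.le)
    calc M * (k * ((2 * t + 1) * (d + 1) ^ j)) ≤ M * (k * ((2 * t + 1) * (2 ^ t * d ^ j))) := by
          gcongr
      _ = _ := by ring
  have hsub : nbWalks G r t ⊆ blockedWalks G C r t ∪ (range t).biUnion bad := by
    intro f hf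
    by_cases hb : f ∈ blockedWalks G C r t
    · exact mem_union_left _ hb
    · refine mem_union_right _ ?_
      have := hcon f hf hb
      simp only [Safe, not_forall, not_le] at this
      obtain ⟨j, hj, hlt⟩ := this
      -- At radius `t + 1` safety is automatic, since `M * k ≤ d ^ t`.
      have hjt : j < t := by
        rcases hj.lt_or_eq with h | rfl
        · exact h
        · exfalso
          have h1 := Nat.mul_le_mul_left M (copsNear_le (G := G) C (f j) (j + 1))
          have h3 : M * k ≤ (2 ^ j * j * M ^ 2 * (2 * j + 1) + 1) * k := by
            refine Nat.mul_le_mul_right _ (le_trans ?_ (Nat.le_succ _))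
            have : 1 * (M * M) * 1 ≤ 2 ^ j * j * M ^ 2 * (2 * j + 1) := by
              rw [← sq]
              gcongr
              · exact Nat.mul_pos (by positivity) ht
              · omega
            nlinarith
          omega
      exact mem_biUnion.2 ⟨j, mem_range.2 hjt, mem_filter.2 ⟨mem_filter.2 ⟨hf, hb⟩, hlt⟩⟩
  have hbl := card_blockedWalks_le hG hd hM2 hC le_rfl
  have hcard : (nbWalks G r t).card ≤
      (blockedWalks G C r t).card + t * (M * k * (2 * t + 1) * 2 ^ t) := by
    refine (card_le_card hsub).trans ((card_union_le _ _).trans (Nat.add_le_add_left ?_ _))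
    simpa using card_biUnion_le_card_mul (range t) bad _ fun j hj => hbad j (mem_range.1 hj)
  have hlow := two_pow_mul_card_nbWalks (r := r) hd h2 t
  have hpos : 0 < d ^ t := by positivity
  have hfin : M * d ^ t ≤ 2 ^ t * (t * d ^ t) + 2 ^ t * (2 ^ t * t * M ^ 2 * (2 * t + 1) * k) :=
    calc M * d ^ t ≤ M * (2 ^ t * ((blockedWalks G C r t).card +
          t * (M * k * (2 * t + 1) * 2 ^ t))) := by gcongr; exact hlow.trans (by gcongr)
      _ = 2 ^ t * (M * (blockedWalks G C r t).card) +
          2 ^ t * (2 ^ t * t * M ^ 2 * (2 * t + 1) * k) := by ring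
      _ ≤ _ := by gcongr
  have hlt : 2 ^ t * t * M ^ 2 * (2 * t + 1) * k < d ^ t := by
    rcases Nat.eq_zero_or_pos k with rfl | hk0
    · simpa using hpos
    · rw [add_mul, one_mul] at hk
      omega
  have hlt' := Nat.mul_lt_mul_of_pos_left hlt (show 0 < 2 ^ t by positivity)
  have : M * d ^ t = 2 ^ t * (t * d ^ t) + 2 ^ t * d ^ t := by rw [hM]; ring
  omega

/-- Unsafe vertices number `O(k * d)`, whereas the ends of walks of length `t + 1` already give at
least `(d / 2) ^ (t + 1)` vertices. -/
theorem exists_safe_start [Nonempty V] (ht : 1 ≤ t) (hG : UniqueWalks G (t + 1))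
    (hd : Regular G d) (h2 : 2 ≤ d) (hM : M = 2 ^ t * (t + 1))
    (hk : (2 ^ t * t * M ^ 2 * (2 * t + 1) + 1) * k ≤ d ^ t) (C : Fin k → V) :
    ∃ v, Safe G t d M C v := by
  classical
  by_contra hcon
  push Not at hcon
  set bad : ℕ → Finset V := fun j =>
    univ.filter fun v => d ^ j < M * (univ.filter fun i => v ∈ ball G (C i) (j + 1)).card
  have hM2 : 2 ^ t * 2 ≤ M := by rw [hM]; gcongr; omega
  have hbad : ∀ j < t, (bad j).card ≤ M * k * (2 ^ t * d) := by
    intro j hj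
    have h1 : ∀ i, ((univ : Finset V).filter fun v => v ∈ ball G (C i) (j + 1)).card ≤
        (d + 1) ^ (j + 1) := fun i => by simpa using card_ball_le hd (C i) (j + 1)
    have h2 := card_filter_lt_mul_le univ (fun v i => v ∈ ball G (C i) (j + 1)) (d ^ j) M h1
    refine Nat.le_of_mul_le_mul_left (h2.trans ?_) (show 0 < d ^ j by positivity)
    have h3 : (d + 1) ^ (j + 1) ≤ 2 ^ t * d ^ (j + 1) :=
      calc (d + 1) ^ (j + 1) ≤ (2 * d) ^ (j + 1) := Nat.pow_le_pow_left (by omega) _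
        _ = 2 ^ (j + 1) * d ^ (j + 1) := mul_pow _ _ _
        _ ≤ _ := Nat.mul_le_mul_right _ (Nat.pow_le_pow_right (by omega) hj)
    calc M * (k * (d + 1) ^ (j + 1)) ≤ M * (k * (2 ^ t * d ^ (j + 1))) := by gcongr
      _ = _ := by ring
  have hkd : M * k < d ^ t ∧ 2 ^ t * 2 * 2 ^ t * t * M * k < d ^ t := by
    rcases Nat.eq_zero_or_pos k with rfl | hk0
    · have : 0 < d ^ t := by positivity
      simpa using this
    · have h3 : 2 ^ t * 2 * 2 ^ t * t * M ≤ 2 ^ t * t * M ^ 2 * (2 * t + 1) :=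
        calc 2 ^ t * 2 * 2 ^ t * t * M ≤ M * 2 ^ t * t * M := by gcongr
          _ = 2 ^ t * t * M ^ 2 * 1 := by ring
          _ ≤ _ := by gcongr; omega
      have h4 : M ≤ 2 ^ t * 2 * 2 ^ t * t * M :=
        Nat.le_mul_of_pos_left _ (Nat.mul_pos (by positivity) ht)
      have h5 := Nat.mul_le_mul_right k h3
      have h6 := Nat.mul_le_mul_right k h4
      rw [add_mul, one_mul] at hk
      omega
  have hsub : (univ : Finset V) ⊆ (range t).biUnion bad := by
    intro v _
    have := hcon v
    simp only [Safe, not_forall, not_le] at this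
    obtain ⟨j, hj, hlt⟩ := this
    have hjt : j < t := by
      rcases hj.lt_or_eq with h | rfl
      · exact h
      · have h1 := Nat.mul_le_mul_left M (copsNear_le (G := G) C v (j + 1))
        omega
    exact mem_biUnion.2 ⟨j, mem_range.2 hjt, mem_filter.2 ⟨mem_univ _, hlt⟩⟩
  have hcard : Fintype.card V ≤ t * (M * k * (2 ^ t * d)) := by
    refine (card_le_card hsub).trans ?_
    simpa using card_biUnion_le_card_mul (range t) bad _ fun j hj => hbad j (mem_range.1 hj)
  obtain ⟨r⟩ := ‹Nonempty V›
  have hV : (nbWalks G r (t + 1)).card ≤ Fintype.card V :=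
    card_le_card_of_injOn (t := univ) (fun f => f (t + 1)) (fun _ _ => mem_univ _)
      fun f hf g hg h => nbWalks_injOn hG le_rfl hf hg h
  have hlow := two_pow_mul_card_nbWalks (r := r) hd h2 (t + 1)
  have h7 : d * d ^ t ≤ d * (2 ^ t * 2 * 2 ^ t * t * M * k) :=
    calc d * d ^ t = d ^ (t + 1) := by ring
      _ ≤ 2 ^ (t + 1) * (t * (M * k * (2 ^ t * d))) :=
          hlow.trans (Nat.mul_le_mul_left _ (hV.trans hcard))
      _ = _ := by ring
  have := Nat.le_of_mul_le_mul_left h7 (by omega)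
  omega

theorem not_copsWin [Nonempty V] (ht : 1 ≤ t) (hG : UniqueWalks G (t + 1))
    (hd : Regular G d) (h2 : 2 ≤ d) (hM : M = 2 ^ t * (t + 1))
    (hk : (2 ^ t * t * M ^ 2 * (2 * t + 1) + 1) * k ≤ d ^ t) : ¬ CopsWin G t k := by
  classical
  rintro ⟨σ, hσ⟩
  have hM2 : 2 ≤ M := by
    have := Nat.mul_le_mul (Nat.one_le_two_pow (n := t)) (show 2 ≤ t + 1 by omega)
    omega
  have hstep : ∀ x : {x : List V × V // Safe G t d M (σ.pos x.1) x.2},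
      ∃ v, RobberMove G t (σ.pos (x.1.2 :: x.1.1)) x.1.2 v ∧
        Safe G t d M (σ.pos (x.1.2 :: x.1.1)) v := by
    rintro ⟨⟨h, r⟩, hr⟩
    obtain ⟨f, hf, hb, hs⟩ := exists_safe_walk ht hG hd h2 hM hk
      (C := σ.pos (r :: h)) (fun j hj => hr.of_cops_move (σ.legal r h) hj)
    refine ⟨f t, ?_, hs⟩
    obtain ⟨p, hp, hps⟩ := exists_walk_of_mem_nbWalks hf
    -- The rules ask for a path; shortcutting the walk keeps its ends and adds no vertices.
    refine ⟨p.bypass, p.bypass_isPath, (p.length_bypass_le_length).trans hp.le, fun x hx i hi => ?_⟩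
    obtain ⟨m, hm, h'⟩ := hps x (p.support_bypass_subset_support hx)
    exact hb (mem_filter.2 ⟨hf, i, m, hm, h'.trans hi.symm⟩)
  choose next hmove hsafe using hstep
  obtain ⟨v₀, hv₀⟩ := exists_safe_start ht hG hd h2 hM hk (σ.pos [])
  -- A state pairs the past, to which the cops have already reacted, with the robber's present
  -- vertex, to which they have not.
  let state : ℕ → {x : List V × V // Safe G t d M (σ.pos x.1) x.2} := fun j =>
    Nat.rec ⟨([], v₀), hv₀⟩ (fun _ x => ⟨(x.1.2 :: x.1.1, next x), hsafe x⟩) j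
  let ρ : ℕ → V := fun j => (state j).1.2
  have hhist : ∀ j, history ρ j = (state j).1.1 := by
    intro j
    induction j with
    | zero => rfl
    | succ j ih =>
      rw [history, ih]
  have hlegal : LegalPlay t σ ρ := by
    intro j _
    have := hmove (state j)
    rw [copsAt, history, hhist]
    exact this
  obtain ⟨j, i, hj⟩ := hσ ρ hlegal
  have hs := (state j).2.ne_and_not_adj hM2 i
  rw [copsAt, copsAt, history, hhist] at hj
  rcases hj with hj | hj
  · exact hs (Or.inl hj.symm)
  · rcases σ.legal (ρ j) (state j).1.1 i with h | h
    · exact hs (Or.inl (hj.symm.trans h))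
    · rw [hj] at h
      exact hs (Or.inr h)

end Game
end FastRobber

namespace FastRobber
open Finset Function

/-! ### Cloning vertices, and reaching every number of vertices -/

section Transfer

theorem CopsWin.mono_speed {V : Type*} {G : SimpleGraph V} {t t' k : ℕ} (h : t ≤ t')
    (hw : CopsWin G t' k) : CopsWin G t k := by
  obtain ⟨σ, hσ⟩ := hw
  refine ⟨σ, fun ρ hρ => hσ ρ fun j hj => ?_⟩
  obtain ⟨p, hp, hl, hs⟩ := hρ j hj
  exact ⟨p, hp, hl.trans h, hs⟩

theorem history_comp {V W : Type*} (e : V → W) (ρ : ℕ → V) (j : ℕ) :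
    history (e ∘ ρ) j = (history ρ j).map e := by
  induction j with
  | zero => rfl
  | succ j ih => simp [history, ih]

/-- `G.comap f` replaces vertices by nonadjacent clones. The cops on `G` imagine the robber on the
section `e` and project the winning strategy by `f`; a cop on the lifted path would project to a cop
on her actual path. -/
theorem CopsWin.of_comap {V W : Type*} {G : SimpleGraph V} {t k : ℕ} {f : W → V} {e : V → W}
    (hfe : ∀ v, f (e v) = v) (hw : CopsWin (G.comap f) t k) : CopsWin G t k := by
  obtain ⟨σ, hσ⟩ := hw
  let σ' : CopStrategy G k :=
    { pos := fun h i => f (σ.pos (h.map e) i)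
      legal := fun r h i => (σ.legal (e r) (h.map e) i).imp (congrArg f) id }
  have hcop : ∀ (ρ : ℕ → V) j i, copsAt σ' ρ j i = f (copsAt σ (e ∘ ρ) j i) := by
    intro ρ j i
    simp only [copsAt, history_comp, σ']
  refine ⟨σ', fun ρ hρ => ?_⟩
  by_contra hnot
  push Not at hnot
  obtain ⟨j, i, hj⟩ := hσ (e ∘ ρ) fun j _ => by
    obtain ⟨p, hp, hl, hs⟩ := hρ j fun m _ => hnot m
    let E : G →g G.comap f := ⟨e, fun {a b} h => by
      rwa [SimpleGraph.comap_adj, hfe, hfe]⟩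
    have hE : Injective E := LeftInverse.injective hfe
    refine ⟨p.map E, hp.map hE, by simpa using hl,
      fun x hx i hi => ?_⟩
    rw [SimpleGraph.Walk.support_map, List.mem_map] at hx
    obtain ⟨y, hy, rfl⟩ := hx
    refine hs y hy i ?_
    rw [hcop, hi]
    exact hfe y
  refine hnot j ⟨i, ?_⟩
  rw [hcop, hcop]
  refine hj.imp (fun h => ?_) (fun h => ?_) <;> rw [h] <;> exact hfe _

theorem not_copsWin_zero {V : Type*} [Nonempty V] (G : SimpleGraph V) (t : ℕ) :
    ¬ CopsWin G t 0 := by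
  rintro ⟨σ, hσ⟩
  obtain ⟨v⟩ := ‹Nonempty V›
  obtain ⟨-, i, -⟩ := hσ (fun _ => v) fun _ _ =>
    ⟨SimpleGraph.Walk.nil, by simp, by simp, fun _ _ i => i.elim0⟩
  exact i.elim0

theorem copsWin_copNumber {V : Type*} [Finite V] (G : SimpleGraph V) (t : ℕ) :
    CopsWin G t (copNumber G t) :=
  Nat.sInf_mem (s := {k : ℕ | CopsWin G t k}) (exists_copsWin G t)

/-- Clones are not adjacent, so each reaches its representative through a common neighbour. -/
theorem connected_comap {V W : Type*} {G : SimpleGraph V} (hG : G.Connected) {f : W → V}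
    {e : V → W} (hfe : ∀ v, f (e v) = v) (hnb : ∀ v, ∃ w, G.Adj v w) :
    (G.comap f).Connected := by
  let E : G →g G.comap f := ⟨e, fun {a b} h => by rwa [SimpleGraph.comap_adj, hfe, hfe]⟩
  have key : ∀ x, (G.comap f).Reachable x (e (f x)) := by
    intro x
    obtain ⟨w, hw⟩ := hnb (f x)
    have h1 : (G.comap f).Adj x (e w) := by rwa [SimpleGraph.comap_adj, hfe]
    have h2 : (G.comap f).Adj (e w) (e (f x)) := by
      rw [SimpleGraph.comap_adj, hfe, hfe]
      exact hw.symm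
    exact h1.reachable.trans h2.reachable
  obtain ⟨v⟩ := hG.nonempty
  have : Nonempty W := ⟨e v⟩
  refine ⟨fun x y => (key x).trans (((hG.preconnected (f x) (f y)).map E).trans (key y).symm)⟩

theorem regular_induce_supp {V : Type*} [Fintype V] {G : SimpleGraph V} {d : ℕ}
    (hd : Regular G d) (c : G.ConnectedComponent) [Fintype c.supp] :
    Regular (G.induce c.supp) d := by
  classical
  intro v
  rw [← hd v.1, ← card_map (Embedding.subtype _)]
  congr 1
  ext w
  simp only [mem_map, mem_filter, mem_univ, true_and, SimpleGraph.comap_adj,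
    Embedding.subtype_apply]
  constructor
  · rintro ⟨u, hu, rfl⟩
    exact hu
  · intro h
    refine ⟨⟨w, ?_⟩, h, rfl⟩
    have hv := v.2
    rw [SimpleGraph.ConnectedComponent.mem_supp_iff] at hv ⊢
    rw [← hv]
    exact SimpleGraph.ConnectedComponent.sound h.symm.reachable

/-- A regular graph with unique short walks gives a connected graph on any larger number of
vertices with large cop number. -/
theorem exists_connected_of_regular {V : Type*} [Fintype V] [Nonempty V] {G : SimpleGraph V}
    {d t t' n : ℕ} (ht : 1 ≤ t) (htt : t ≤ t') (hG : UniqueWalks G (t + 1)) (hd : Regular G d)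
    (h2 : 2 ≤ d) (hn : Fintype.card V ≤ n) :
    ∃ H : SimpleGraph (Fin n), H.Connected ∧
      d ^ t < (2 ^ t * t * (2 ^ t * (t + 1)) ^ 2 * (2 * t + 1) + 1) * copNumber H t' := by
  classical
  obtain ⟨v₀⟩ := ‹Nonempty V›
  set c := G.connectedComponentMk v₀
  set G' := G.induce c.supp
  have hne : Nonempty c.supp := ⟨⟨v₀, rfl⟩⟩
  have hd' : Regular G' d := regular_induce_supp hd c
  have hG' : UniqueWalks G' (t + 1) :=
    hG.comap Subtype.val Subtype.val_injective fun _ _ h => h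
  have hcon : G'.Connected := c.connected_toSimpleGraph
  have hcard : Fintype.card c.supp ≤ Fintype.card (Fin n) := by
    rw [Fintype.card_fin]
    exact (Fintype.card_subtype_le _).trans hn
  obtain ⟨e⟩ := Embedding.nonempty_of_card_le hcard
  have hfe : ∀ v, invFun e (e v) = v := leftInverse_invFun e.injective
  -- All surplus vertices become clones of the one default vertex of `invFun`.
  refine ⟨G'.comap (invFun e), connected_comap hcon hfe fun v => ?_, ?_⟩
  · have h := hd' v
    obtain ⟨w, hw⟩ : (univ.filter fun w => G'.Adj v w).Nonempty := by
      rw [← card_pos]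
      exact lt_of_lt_of_eq (by omega) h.symm
    exact ⟨w, (mem_filter.1 hw).2⟩
  · by_contra hle
    refine not_copsWin ht hG' hd' h2 rfl (not_lt.1 hle)
      (((copsWin_copNumber _ t').mono_speed htt).of_comap hfe)

theorem exists_forall_connected_le_copNumber {t : ℕ} (ht : 1 ≤ t)
    (hfam : ∀ q : ℕ, q.Prime → 3 ≤ q → ∃ (V : Type) (_ : Fintype V) (_ : Nonempty V)
      (G : SimpleGraph V), Fintype.card V ≤ 2 * q ^ (t + 1) ∧ Regular G q ∧
        UniqueWalks G (t + 1)) {t' : ℕ} (htt : t ≤ t') :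
    ∃ c : ℝ, 0 < c ∧ ∀ n : ℕ, 1 ≤ n → ∃ G : SimpleGraph (Fin n), G.Connected ∧
      c * (n : ℝ) ^ ((t : ℝ) / (t + 1)) ≤ (copNumber G t' : ℝ) := by
  set K : ℕ := 2 ^ t * t * (2 ^ t * (t + 1)) ^ 2 * (2 * t + 1) + 1 with hK
  set A : ℕ := 2 * 4 ^ (t + 1) with hA
  have hA1 : (1 : ℝ) ≤ A := by
    rw [hA]
    exact_mod_cast (show 0 < 2 * 4 ^ (t + 1) by positivity)
  have hK1 : (1 : ℝ) ≤ K := by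
    rw [hK]
    exact_mod_cast Nat.succ_le_succ (Nat.zero_le _)
  have ht0 : (0 : ℝ) ≤ (t : ℝ) / (t + 1) := by positivity
  have ht1 : (t : ℝ) / (t + 1) ≤ 1 := by
    rw [div_le_one (by positivity)]
    linarith
  refine ⟨1 / (A * K), by positivity, fun n hn => ?_⟩
  have hn1 : (1 : ℝ) ≤ n := by exact_mod_cast hn
  rw [div_mul_eq_mul_div, one_mul]
  simp only [div_le_iff₀ (show (0 : ℝ) < A * K by positivity)]
  -- A prime `q` with `m < q ≤ 2 * m` gives a graph that fits into `n` vertices, while maximality of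
  -- `m` gives `n ≤ A * q ^ (t + 1)`. If `m < 2`, then `n ≤ A` and one cop being necessary suffices.
  set P : ℕ → Prop := fun m => 2 * (2 * m) ^ (t + 1) ≤ n
  set m := Nat.findGreatest P n with hm
  have hP0 : P 0 := by simp [P]
  have hPm : P m := Nat.findGreatest_spec (Nat.zero_le _) hP0
  have hPm1 : n < 2 * (2 * (m + 1)) ^ (t + 1) := by
    by_cases hmn : m + 1 ≤ n
    · exact not_le.1 (Nat.findGreatest_is_greatest (P := P) (Nat.lt_succ_self _) hmn)
    · calc n < m + 1 := by omega
        _ ≤ 2 * (m + 1) := by omega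
        _ ≤ (2 * (m + 1)) ^ (t + 1) := Nat.le_self_pow (by omega) _
        _ ≤ _ := by omega
  rcases Nat.lt_or_ge m 2 with hm2 | hm2
  · have hne : Nonempty (Fin n) := ⟨⟨0, hn⟩⟩
    refine ⟨⊤, SimpleGraph.connected_top, ?_⟩
    have hpos : (1 : ℝ) ≤ copNumber (⊤ : SimpleGraph (Fin n)) t' := by
      have : copNumber (⊤ : SimpleGraph (Fin n)) t' ≠ 0 := fun h =>
        not_copsWin_zero _ t' (h ▸ copsWin_copNumber (⊤ : SimpleGraph (Fin n)) t')
      exact_mod_cast Nat.one_le_iff_ne_zero.2 this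
    have hnA : (n : ℝ) ≤ A := by
      have : n ≤ A := hPm1.le.trans (by rw [hA]; gcongr; omega)
      exact_mod_cast this
    calc (n : ℝ) ^ ((t : ℝ) / (t + 1)) ≤ (n : ℝ) ^ (1 : ℝ) :=
          Real.rpow_le_rpow_of_exponent_le hn1 ht1
      _ = 1 * (n * 1) := by rw [Real.rpow_one]; ring
      _ ≤ copNumber (⊤ : SimpleGraph (Fin n)) t' * (A * K) := by gcongr
  · obtain ⟨q, hq, hmq, hqm⟩ := Nat.exists_prime_lt_and_le_two_mul m (by omega)
    obtain ⟨V, _, _, G, hV, hd, hU⟩ := hfam q hq (by omega)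
    obtain ⟨H, hH, hlt⟩ := exists_connected_of_regular (n := n) ht htt hU hd (by omega)
      (hV.trans (le_trans (by gcongr) hPm))
    refine ⟨H, hH, ?_⟩
    have hlt' : (q : ℝ) ^ t ≤ K * copNumber H t' := by exact_mod_cast hlt.le
    have hnq : (n : ℝ) ≤ A * (q : ℝ) ^ (t + 1) := by
      have : n ≤ A * q ^ (t + 1) :=
        calc n ≤ 2 * (2 * (m + 1)) ^ (t + 1) := hPm1.le
          _ ≤ 2 * (4 * q) ^ (t + 1) := by gcongr <;> omega
          _ = _ := by rw [mul_pow, hA]; ring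
      exact_mod_cast this
    have hqpow : ((q : ℝ) ^ (t + 1)) ^ ((t : ℝ) / (t + 1)) = (q : ℝ) ^ t := by
      rw [← Real.rpow_natCast, ← Real.rpow_mul (by positivity), ← Real.rpow_natCast]
      congr 1
      push_cast
      field_simp
    calc (n : ℝ) ^ ((t : ℝ) / (t + 1)) ≤ (A * (q : ℝ) ^ (t + 1)) ^ ((t : ℝ) / (t + 1)) := by
          gcongr
      _ = (A : ℝ) ^ ((t : ℝ) / (t + 1)) * (q : ℝ) ^ t := by
          rw [Real.mul_rpow (by positivity) (by positivity), hqpow]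
      _ ≤ (A : ℝ) ^ (1 : ℝ) * (K * copNumber H t') := by
          gcongr
      _ = _ := by rw [Real.rpow_one]; ring

end Transfer
end FastRobber

namespace FastRobber
open Finset Function

/-! ### Unique walks in incidence graphs without short polygons -/

section Incidence

variable {P L : Type*}

/-- The incidence graph of an incidence relation between points and lines. -/
def incidenceGraph (I : P → L → Prop) : SimpleGraph (P ⊕ L) where
  Adj
    | .inl p, .inr l => I p l
    | .inr l, .inl p => I p l
    | _, _ => False
  symm := ⟨by rintro (p | l) (p' | l') h <;> exact h⟩
  loopless := ⟨by rintro (p | l) h <;> exact h⟩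

theorem incidenceGraph_adj_inl {I : P → L → Prop} {p : P} {v : P ⊕ L}
    (h : (incidenceGraph I).Adj (.inl p) v) : ∃ l, v = .inr l ∧ I p l := by
  rcases v with v | v
  · exact h.elim
  · exact ⟨v, rfl, h⟩

theorem incidenceGraph_adj_inr {I : P → L → Prop} {l : L} {v : P ⊕ L}
    (h : (incidenceGraph I).Adj (.inr l) v) : ∃ p, v = .inl p ∧ I p l := by
  rcases v with v | v
  · exact ⟨v, rfl, h⟩
  · exact h.elim

theorem regular_incidenceGraph [Fintype P] [Fintype L] {K : Type*} [Fintype K]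
    {I : P → L → Prop} (line : P → K → L) (point : L → K → P)
    (hline : ∀ p, Injective (line p)) (hpoint : ∀ l, Injective (point l))
    (hl : ∀ p l, I p l ↔ ∃ b, line p b = l) (hp : ∀ p l, I p l ↔ ∃ a, point l a = p) :
    Regular (incidenceGraph I) (Fintype.card K) := by
  classical
  rintro (p | l)
  · rw [← card_univ, ← card_map ⟨fun b => Sum.inr (line p b), Sum.inr_injective.comp (hline p)⟩]
    congr 1
    ext v
    simp only [mem_filter, mem_univ, true_and, mem_map, Embedding.coeFn_mk]
    constructor
    · intro h
      obtain ⟨l, rfl, h⟩ := incidenceGraph_adj_inl h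
      obtain ⟨b, rfl⟩ := (hl p l).1 h
      exact ⟨b, rfl⟩
    · rintro ⟨b, rfl⟩
      exact (hl p _).2 ⟨b, rfl⟩
  · rw [← card_univ, ← card_map ⟨fun b => Sum.inl (point l b), Sum.inl_injective.comp (hpoint l)⟩]
    congr 1
    ext v
    simp only [mem_filter, mem_univ, true_and, mem_map, Embedding.coeFn_mk]
    constructor
    · intro h
      obtain ⟨p, rfl, h⟩ := incidenceGraph_adj_inr h
      obtain ⟨a, rfl⟩ := (hp p l).1 h
      exact ⟨a, rfl⟩
    · rintro ⟨a, rfl⟩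
      exact (hp _ l).2 ⟨a, rfl⟩

/-- There is no closed polygon with `s` points and `s` lines: a cyclic sequence in which the line
`l i` joins `p i` and `p (i + 1)`, and consecutive points and consecutive lines are distinct. -/
def NoPolygon (I : P → L → Prop) (s : ℕ) : Prop :=
  ∀ (p : ℕ → P) (l : ℕ → L), (∀ i < s, I (p i) (l i)) → (∀ i < s, I (p (i + 1)) (l i)) →
    p s = p 0 → (∀ i < s, p i ≠ p (i + 1)) → (∀ i, i + 1 < s → l i ≠ l (i + 1)) →
    l (s - 1) ≠ l 0 → False

variable {I : P → L → Prop}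

theorem NoPolygon.not_closed_of_inl {s : ℕ} (h : NoPolygon I s) (hs : 2 ≤ s) {z : ℕ → P ⊕ L}
    (hz : Nonbacktracking (incidenceGraph I) z (2 * s)) (hc : z (2 * s) = z 0)
    (hne : z (2 * s - 1) ≠ z 1) {p₀ : P} (h0 : z 0 = .inl p₀) : False := by
  have heven : ∀ i ≤ s, ∃ p, z (2 * i) = .inl p := by
    intro i
    induction i with
    | zero => exact fun _ => ⟨p₀, h0⟩
    | succ i ih =>
      intro hi
      obtain ⟨p, hp⟩ := ih (by omega)
      have h1 := hz.1 (2 * i) (by omega)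
      rw [hp] at h1
      obtain ⟨l, hl, -⟩ := incidenceGraph_adj_inl h1
      have h2 := hz.1 (2 * i + 1) (by omega)
      rw [hl] at h2
      obtain ⟨p', hp', -⟩ := incidenceGraph_adj_inr h2
      exact ⟨p', hp'⟩
  have hodd : ∀ i < s, ∃ l, z (2 * i + 1) = .inr l := by
    intro i hi
    obtain ⟨p, hp⟩ := heven i hi.le
    have h1 := hz.1 (2 * i) (by omega)
    rw [hp] at h1
    obtain ⟨l, hl, -⟩ := incidenceGraph_adj_inl h1
    exact ⟨l, hl⟩
  obtain ⟨l₀, -⟩ := hodd 0 (by omega)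
  let p : ℕ → P := fun i => Sum.elim id (fun _ => p₀) (z (2 * i))
  let l : ℕ → L := fun i => Sum.elim (fun _ => l₀) id (z (2 * i + 1))
  have hp : ∀ i ≤ s, z (2 * i) = .inl (p i) := fun i hi => by
    obtain ⟨p', hp'⟩ := heven i hi
    simp [p, hp']
  have hl : ∀ i < s, z (2 * i + 1) = .inr (l i) := fun i hi => by
    obtain ⟨l', hl'⟩ := hodd i hi
    simp [l, hl']
  refine h p l (fun i hi => ?_) (fun i hi => ?_) ?_ (fun i hi he => ?_) (fun i hi he => ?_) ?_
  · have := hz.1 (2 * i) (by omega)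
    rwa [hp i hi.le, hl i hi] at this
  · have := hz.1 (2 * i + 1) (by omega)
    rwa [hl i hi, show 2 * i + 1 + 1 = 2 * (i + 1) by ring, hp (i + 1) hi] at this
  · rw [hp s le_rfl, ← mul_zero 2, hp 0 (by omega)] at hc
    exact Sum.inl_injective hc
  · refine hz.2 (2 * i) (by omega) ?_
    rw [show 2 * i + 2 = 2 * (i + 1) by ring, hp i hi.le, hp (i + 1) hi, he]
  · refine hz.2 (2 * i + 1) (by omega) ?_
    rw [show 2 * i + 1 + 2 = 2 * (i + 1) + 1 by ring, hl i (by omega), hl (i + 1) hi, he]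
  · intro he
    refine hne ?_
    have h1 := hl 0 (by omega)
    rw [show 2 * s - 1 = 2 * (s - 1) + 1 by omega, hl (s - 1) (by omega), he, ← h1]

theorem NoPolygon.not_closed {s : ℕ} (h : NoPolygon I s) (hs : 2 ≤ s) {z : ℕ → P ⊕ L}
    (hz : Nonbacktracking (incidenceGraph I) z (2 * s)) (hc : z (2 * s) = z 0)
    (hne : z (2 * s - 1) ≠ z 1) : False := by
  rcases h0 : z 0 with p | l
  · exact h.not_closed_of_inl hs hz hc hne h0
  · have h1 := hz.1 0 (by omega)
    rw [h0] at h1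
    obtain ⟨p, hp, -⟩ := incidenceGraph_adj_inr h1
    -- A closed walk that starts at a line is rotated by one step to start at a point.
    refine h.not_closed_of_inl (z := fun i => if i = 2 * s then z 1 else z (i + 1)) hs
      ⟨fun i hi => ?_, fun i hi => ?_⟩ ?_ ?_ (p₀ := p) ?_
    · beta_reduce
      rw [if_neg (by omega)]
      split_ifs with h2
      · rw [h2, hc]
        exact hz.1 0 (by omega)
      · exact hz.1 (i + 1) (by omega)
    · beta_reduce
      rw [if_neg (by omega)]
      split_ifs with h2
      · rwa [show i + 1 = 2 * s - 1 by omega]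
      · exact hz.2 (i + 1) (by omega)
    · rw [if_pos rfl, if_neg (by omega)]
    · rw [if_neg (by omega), if_neg (by omega), Nat.sub_add_cancel (by omega), hc]
      exact hz.2 0 (by omega)
    · rw [if_neg (by omega)]
      exact hp

theorem uniqueWalks_one : UniqueWalks (incidenceGraph I) 1 := by
  intro s hs x y _ _ h0 _
  obtain rfl : s = 0 := by omega
  exact h0

/-- Two walks with different last steps either share the first step, which can be dropped, or close
up, `x` followed by `y` reversed, to a forbidden polygon. -/
theorem UniqueWalks.succ {m : ℕ} (h : UniqueWalks (incidenceGraph I) (m + 1))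
    (hm : NoPolygon I (m + 2)) : UniqueWalks (incidenceGraph I) (m + 2) := by
  intro s hs x y hx hy h0 h1
  rcases Nat.lt_succ_iff_lt_or_eq.1 hs with hs | rfl
  · exact h s hs x y hx hy h0 h1
  by_contra hne
  by_cases h2 : x 1 = y 1
  · exact hne (h m (by omega) (fun i => x (i + 1)) (fun i => y (i + 1))
      ⟨fun i hi => hx.1 (i + 1) (by omega), fun i hi => hx.2 (i + 1) (by omega)⟩
      ⟨fun i hi => hy.1 (i + 1) (by omega), fun i hi => hy.2 (i + 1) (by omega)⟩ h2 h1)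
  refine hm.not_closed (by omega)
    (z := fun i => if i ≤ m + 2 then x i else y (2 * (m + 2) - i))
    ⟨fun i hi => ?_, fun i hi => ?_⟩ ?_ ?_
  · beta_reduce
    rcases lt_trichotomy i (m + 2) with h3 | rfl | h3
    · rw [if_pos h3.le, if_pos (by omega)]
      exact hx.1 i h3
    · rw [if_pos le_rfl, if_neg (by omega), h1, show 2 * (m + 2) - (m + 2 + 1) = m + 1 by omega]
      exact (hy.1 (m + 1) (by omega)).symm
    · rw [if_neg (by omega), if_neg (by omega)]
      have := hy.1 (2 * (m + 2) - (i + 1)) (by omega)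
      rw [show 2 * (m + 2) - (i + 1) + 1 = 2 * (m + 2) - i by omega] at this
      exact this.symm
  · beta_reduce
    rcases lt_trichotomy i (m + 1) with h3 | rfl | h3
    · rw [if_pos (by omega), if_pos (by omega)]
      exact hx.2 i (by omega)
    · rw [if_pos (by omega), if_neg (by omega),
        show 2 * (m + 2) - (m + 1 + 2) = m + 1 by omega]
      exact hne
    · have h4 := hy.2 (2 * (m + 2) - (i + 2)) (by omega)
      rw [show 2 * (m + 2) - (i + 2) + 2 = 2 * (m + 2) - i by omega] at h4
      rw [if_neg (show ¬ i + 2 ≤ m + 2 by omega)]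
      split_ifs with h5
      · obtain rfl : i = m + 2 := by omega
        rw [h1]
        rw [show 2 * (m + 2) - (m + 2) = m + 1 + 1 by omega] at h4
        exact h4.symm
      · exact h4.symm
  · rw [if_neg (by omega), if_pos (by omega), Nat.sub_self, h0]
  · rw [if_neg (by omega), if_pos (by omega),
      show 2 * (m + 2) - (2 * (m + 2) - 1) = 1 by omega]
    exact Ne.symm h2

end Incidence

/-! ### Coordinates for the quadrangle and the hexagon -/

section Polygons

variable {K : Type*} [Field K]

/-- Incidence in the affine part of the symplectic generalized quadrangle. -/
def QuadrangleInc (p l : K × K × K) : Prop :=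
  p.2.1 + l.2.1 = p.1 * l.1 ∧ p.2.2 + l.2.2 = p.1 * l.2.1

/-- Incidence in the affine part of the split Cayley hexagon. -/
def HexagonInc (p l : K × K × K × K × K) : Prop :=
  p.2.1 + l.2.1 = p.1 * l.1 ∧ p.2.2.1 + l.2.2.1 = p.1 * l.2.1 ∧
    p.2.2.2.1 + l.2.2.2.1 = p.1 * l.2.2.1 ∧
    p.2.2.2.2 + l.2.2.2.2 = p.2.1 * l.2.2.1 - p.2.2.1 * l.2.1

/-- On a given line the first coordinate determines the point; the three analogues below hold for
the same reason. -/
theorem QuadrangleInc.fst_ne_of_points {p p' l : K × K × K} (h : QuadrangleInc p l)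
    (h' : QuadrangleInc p' l) (hne : p ≠ p') : p.1 ≠ p'.1 := by
  obtain ⟨a, u, v⟩ := p
  obtain ⟨a', u', v'⟩ := p'
  obtain ⟨h1, h2⟩ := h
  obtain ⟨h1', h2'⟩ := h'
  simp only at *
  rintro rfl
  obtain rfl : u = u' := by linear_combination h1 - h1'
  obtain rfl : v = v' := by linear_combination h2 - h2'
  exact hne rfl

theorem QuadrangleInc.fst_ne_of_lines {p l l' : K × K × K} (h : QuadrangleInc p l)
    (h' : QuadrangleInc p l') (hne : l ≠ l') : l.1 ≠ l'.1 := by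
  obtain ⟨b, m, n⟩ := l
  obtain ⟨b', m', n'⟩ := l'
  obtain ⟨h1, h2⟩ := h
  obtain ⟨h1', h2'⟩ := h'
  simp only at *
  rintro rfl
  obtain rfl : m = m' := by linear_combination h1 - h1'
  obtain rfl : n = n' := by linear_combination h2 - h2'
  exact hne rfl

theorem HexagonInc.fst_ne_of_points {p p' l : K × K × K × K × K} (h : HexagonInc p l)
    (h' : HexagonInc p' l) (hne : p ≠ p') : p.1 ≠ p'.1 := by
  obtain ⟨a, u, v, w, z⟩ := p
  obtain ⟨a', u', v', w', z'⟩ := p'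
  obtain ⟨h1, h2, h3, h4⟩ := h
  obtain ⟨h1', h2', h3', h4'⟩ := h'
  simp only at *
  rintro rfl
  obtain rfl : u = u' := by linear_combination h1 - h1'
  obtain rfl : v = v' := by linear_combination h2 - h2'
  obtain rfl : w = w' := by linear_combination h3 - h3'
  obtain rfl : z = z' := by linear_combination h4 - h4'
  exact hne rfl

theorem HexagonInc.fst_ne_of_lines {p l l' : K × K × K × K × K} (h : HexagonInc p l)
    (h' : HexagonInc p l') (hne : l ≠ l') : l.1 ≠ l'.1 := by
  obtain ⟨b, m, n, f, k⟩ := l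
  obtain ⟨b', m', n', f', k'⟩ := l'
  obtain ⟨h1, h2, h3, h4⟩ := h
  obtain ⟨h1', h2', h3', h4'⟩ := h'
  simp only at *
  rintro rfl
  obtain rfl : m = m' := by linear_combination h1 - h1'
  obtain rfl : n = n' := by linear_combination h2 - h2'
  obtain rfl : f = f' := by linear_combination h3 - h3'
  obtain rfl : k = k' := by linear_combination h4 - h4'
  exact hne rfl

theorem noPolygon_quadrangle_two : NoPolygon (QuadrangleInc (K := K)) 2 := by
  intro p l h h' hc hp hl _
  have h0 := (h 0 (by omega)).1
  have h0' := (h' 0 (by omega)).1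
  have h1 := (h 1 (by omega)).1
  have h1' := (h' 1 (by omega)).1
  have ha := (h 0 (by omega)).fst_ne_of_points (h' 0 (by omega)) (hp 0 (by omega))
  have hb := (h' 0 (by omega)).fst_ne_of_lines (h 1 (by omega)) (hl 0 (by omega))
  simp only [zero_add, Nat.reduceAdd, hc] at *
  refine mul_ne_zero (sub_ne_zero.2 ha) (sub_ne_zero.2 hb) ?_
  linear_combination h0' - h0 + h1' - h1

theorem noPolygon_quadrangle_three : NoPolygon (QuadrangleInc (K := K)) 3 := by
  intro p l h h' hc hp hl _
  obtain ⟨h0, k0⟩ := h 0 (by omega)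
  obtain ⟨h0', k0'⟩ := h' 0 (by omega)
  obtain ⟨h1, k1⟩ := h 1 (by omega)
  obtain ⟨h1', k1'⟩ := h' 1 (by omega)
  obtain ⟨h2, k2⟩ := h 2 (by omega)
  obtain ⟨h2', k2'⟩ := h' 2 (by omega)
  have ha0 := (h 0 (by omega)).fst_ne_of_points (h' 0 (by omega)) (hp 0 (by omega))
  have ha1 := (h 1 (by omega)).fst_ne_of_points (h' 1 (by omega)) (hp 1 (by omega))
  have hb := (h' 0 (by omega)).fst_ne_of_lines (h 1 (by omega)) (hl 0 (by omega))
  simp only [zero_add, Nat.reduceAdd, hc] at *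
  set a0 := (p 0).1
  set a1 := (p 1).1
  set a2 := (p 2).1
  -- `e1` and `e2` say that the displacements along the sides sum to zero; `f1` and `f2` say that
  -- consecutive lines meet. The functional `m - a2 * b` of a line with coordinates `(b, m, _)`
  -- agrees on lines `1` and `2`, so only the contribution of line `0` relative to them survives.
  have e1 : (l 0).1 * (a1 - a0) + (l 1).1 * (a2 - a1) + (l 2).1 * (a0 - a2) = 0 := by
    linear_combination h0 - h0' + h1 - h1' + h2 - h2'
  have e2 : (l 0).2.1 * (a1 - a0) + (l 1).2.1 * (a2 - a1) + (l 2).2.1 * (a0 - a2) = 0 := by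
    linear_combination k0 - k0' + k1 - k1' + k2 - k2'
  have f1 : (l 1).2.1 - (l 0).2.1 = a1 * ((l 1).1 - (l 0).1) := by linear_combination h1 - h0'
  have f2 : (l 2).2.1 - (l 1).2.1 = a2 * ((l 2).1 - (l 1).1) := by linear_combination h2 - h1'
  refine mul_ne_zero (mul_ne_zero (sub_ne_zero.2 ha0) (sub_ne_zero.2 ha1))
    (sub_ne_zero.2 hb) ?_
  linear_combination -e2 + a2 * e1 - (a1 - a0) * f1 - (a2 - a0) * f2

/-- The projection of the hexagon to the quadrangle. -/
def toQuadrangle (p : K × K × K × K × K) : K × K × K := (p.1, p.2.1, p.2.2.1)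

/-- The projection keeps first coordinates, which already separate consecutive points and
consecutive lines. -/
theorem noPolygon_hexagon_of_quadrangle {s : ℕ} (h : NoPolygon (QuadrangleInc (K := K)) s)
    (hs : 2 ≤ s) : NoPolygon (HexagonInc (K := K)) s := by
  intro p l h1 h2 hc hp hl hl'
  let fst : K × K × K → K := Prod.fst
  refine h (toQuadrangle ∘ p) (toQuadrangle ∘ l) (fun i hi => ⟨(h1 i hi).1, (h1 i hi).2.1⟩)
    (fun i hi => ⟨(h2 i hi).1, (h2 i hi).2.1⟩) (congrArg toQuadrangle hc) (fun i hi he => ?_)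
    (fun i hi he => ?_) (fun he => ?_)
  · exact (h1 i hi).fst_ne_of_points (h2 i hi) (hp i hi) (congrArg fst he)
  · exact (h2 i (by omega)).fst_ne_of_lines (h1 (i + 1) hi) (hl i hi) (congrArg fst he)
  · have h3 := h2 (s - 1) (by omega)
    rw [Nat.sub_add_cancel (by omega), hc] at h3
    exact h3.fst_ne_of_lines (h1 0 (by omega)) hl' (congrArg fst he)

/-- The polar form of the quadric that carries the directions of the lines of the hexagon. -/
def polar (l l' : K × K × K × K × K) : K :=
  (l.2.1 - l'.2.1) ^ 2 - (l.1 - l'.1) * (l.2.2.1 - l'.2.2.1)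

theorem polar_comm (l l' : K × K × K × K × K) : polar l l' = polar l' l := by
  rw [polar, polar]
  ring

theorem polar_self (l : K × K × K × K × K) : polar l l = 0 := by
  rw [polar]
  ring

theorem HexagonInc.polar_eq_zero {p l l' : K × K × K × K × K} (h : HexagonInc p l)
    (h' : HexagonInc p l') : polar l l' = 0 := by
  obtain ⟨h1, h2, -⟩ := h
  obtain ⟨h1', h2', -⟩ := h'
  rw [polar]
  linear_combination (l.2.1 - l'.2.1) * (h1 - h1') - (l.1 - l'.1) * (h2 - h2')

theorem HexagonInc.polar_ne_zero {p p' l l' l'' : K × K × K × K × K} (h1 : HexagonInc p l)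
    (h2 : HexagonInc p l') (h3 : HexagonInc p' l') (h4 : HexagonInc p' l'') (hp : p ≠ p')
    (hl : l ≠ l') (hl' : l' ≠ l'') : polar l l'' ≠ 0 := by
  have ha := h2.fst_ne_of_points h3 hp
  have hb := h1.fst_ne_of_lines h2 hl
  have hb' := h3.fst_ne_of_lines h4 hl'
  have key : polar l l'' = -((p.1 - p'.1) ^ 2 * (l.1 - l'.1) * (l'.1 - l''.1)) := by
    obtain ⟨e1, e2, -⟩ := h1
    obtain ⟨e1', e2', -⟩ := h2
    obtain ⟨f1, f2, -⟩ := h3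
    obtain ⟨f1', f2', -⟩ := h4
    have g1 : l.2.1 = l'.2.1 + p.1 * (l.1 - l'.1) := by linear_combination e1 - e1'
    have g2 : l.2.2.1 = l'.2.2.1 + p.1 * (l.2.1 - l'.2.1) := by linear_combination e2 - e2'
    have g3 : l''.2.1 = l'.2.1 - p'.1 * (l'.1 - l''.1) := by linear_combination f1' - f1
    have g4 : l''.2.2.1 = l'.2.2.1 - p'.1 * (l'.2.1 - l''.2.1) := by
      linear_combination f2' - f2
    rw [polar, g2, g4, g1, g3]
    ring
  rw [key]
  exact neg_ne_zero.2 (mul_ne_zero (mul_ne_zero (pow_ne_zero 2 (sub_ne_zero.2 ha))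
    (sub_ne_zero.2 hb)) (sub_ne_zero.2 hb'))

/-- The displacement from `p` to `p'` along the line `l`, paired with the line `l'`. -/
theorem HexagonInc.mul_polar {p p' l : K × K × K × K × K} (h : HexagonInc p l)
    (h' : HexagonInc p' l) (l' : K × K × K × K × K) :
    (p'.1 - p.1) * polar l l' =
      l'.2.2.1 * (p'.2.1 - p.2.1) + l'.1 * (p'.2.2.2.1 - p.2.2.2.1)
        - 2 * l'.2.1 * (p'.2.2.1 - p.2.2.1) - (p'.2.2.2.2 - p.2.2.2.2)
        - (l'.1 * l'.2.2.1 - l'.2.1 ^ 2) * (p'.1 - p.1) := by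
  obtain ⟨h1, h2, h3, h4⟩ := h
  obtain ⟨h1', h2', h3', h4'⟩ := h'
  rw [polar]
  linear_combination (l.2.2.1 - l'.2.2.1) * (h1' - h1) - (l.2.1 - 2 * l'.2.1) * (h2' - h2) -
    l'.1 * (h3' - h3) + (h4' - h4)

theorem sum_mul_polar {s : ℕ} {p l : ℕ → K × K × K × K × K}
    (h : ∀ i < s, HexagonInc (p i) (l i)) (h' : ∀ i < s, HexagonInc (p (i + 1)) (l i))
    (hc : p s = p 0) (l' : K × K × K × K × K) :
    ∑ i ∈ range s, ((p (i + 1)).1 - (p i).1) * polar (l i) l' = 0 := by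
  let F : ℕ → K := fun i => l'.2.2.1 * (p i).2.1 + l'.1 * (p i).2.2.2.1
        - 2 * l'.2.1 * (p i).2.2.1 - (p i).2.2.2.2 - (l'.1 * l'.2.2.1 - l'.2.1 ^ 2) * (p i).1
  calc _ = ∑ i ∈ range s, (F (i + 1) - F i) := sum_congr rfl fun i hi => by
        rw [(h i (mem_range.1 hi)).mul_polar (h' i (mem_range.1 hi))]
        simp only [F]
        ring
    _ = 0 := by rw [sum_range_sub, sub_eq_zero]; simp only [F, hc]

/-- Paired with `l 0`, every side but the opposite one contributes zero, and that one does not. -/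
theorem noPolygon_hexagon_four : NoPolygon (HexagonInc (K := K)) 4 := by
  intro p l h h' hc hp hl hl'
  have hsum := sum_mul_polar h h' hc (l 0)
  have h3 : HexagonInc (p 0) (l 3) := hc ▸ h' 3 (by omega)
  have e1 : polar (l 1) (l 0) = 0 := (h 1 (by omega)).polar_eq_zero (h' 0 (by omega))
  have e3 : polar (l 3) (l 0) = 0 := h3.polar_eq_zero (h 0 (by omega))
  simp only [sum_range_succ, sum_range_zero, polar_self, e1, e3, mul_zero, zero_add,
    add_zero] at hsum
  refine mul_ne_zero (sub_ne_zero.2 (Ne.symm ?_)) ?_ hsum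
  · exact (h 2 (by omega)).fst_ne_of_points (h' 2 (by omega)) (hp 2 (by omega))
  · rw [polar_comm]
    exact (h' 0 (by omega)).polar_ne_zero (h 1 (by omega)) (h' 1 (by omega)) (h 2 (by omega))
      (hp 1 (by omega)) (hl 0 (by omega)) (hl 1 (by omega))

theorem noPolygon_hexagon_five (h2 : (2 : K) ≠ 0) : NoPolygon (HexagonInc (K := K)) 5 := by
  intro p l h h' hc hp hl hl'
  have h4 : HexagonInc (p 0) (l 4) := hc ▸ h' 4 (by omega)
  have e0 : polar (l 0) (l 1) = 0 := (h' 0 (by omega)).polar_eq_zero (h 1 (by omega))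
  have e1 : polar (l 1) (l 2) = 0 := (h' 1 (by omega)).polar_eq_zero (h 2 (by omega))
  have e2 : polar (l 2) (l 3) = 0 := (h' 2 (by omega)).polar_eq_zero (h 3 (by omega))
  have e3 : polar (l 3) (l 4) = 0 := (h' 3 (by omega)).polar_eq_zero (h 4 (by omega))
  have e4 : polar (l 0) (l 4) = 0 := (h 0 (by omega)).polar_eq_zero h4
  have hx : ∀ i < 5, (p (i + 1)).1 - (p i).1 ≠ 0 := fun i hi =>
    sub_ne_zero.2 ((h i hi).fst_ne_of_points (h' i hi) (hp i hi)).symm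
  have hB : polar (l 0) (l 2) ≠ 0 :=
    (h' 0 (by omega)).polar_ne_zero (h 1 (by omega)) (h' 1 (by omega)) (h 2 (by omega))
      (hp 1 (by omega)) (hl 0 (by omega)) (hl 1 (by omega))
  have R := fun j => sum_mul_polar h h' hc (l j)
  have x0 := hx 0 (by omega)
  have x1 := hx 1 (by omega)
  have x2 := hx 2 (by omega)
  have x3 := hx 3 (by omega)
  have x4 := hx 4 (by omega)
  have R0 := R 0
  have R1 := R 1
  have R2 := R 2
  have R3 := R 3
  have R4 := R 4
  rw [polar_comm] at e0 e1 e2 e3 e4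
  simp only [sum_range_succ, sum_range_zero, polar_self, e0, e1, e2, e3, e4,
    polar_comm (l 0) (l 1), polar_comm (l 1) (l 2), polar_comm (l 2) (l 3),
    polar_comm (l 3) (l 4), polar_comm (l 0) (l 4), polar_comm (l 2) (l 0),
    polar_comm (l 3) (l 0), polar_comm (l 3) (l 1), polar_comm (l 4) (l 1),
    polar_comm (l 4) (l 2), mul_zero, zero_add, add_zero] at R0 R1 R2 R3 R4
  simp only [zero_add, Nat.reduceAdd] at *
  generalize (p 1).1 - (p 0).1 = y0 at *
  generalize (p 2).1 - (p 1).1 = y1 at *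
  generalize (p 3).1 - (p 2).1 = y2 at *
  generalize (p 4).1 - (p 3).1 = y3 at *
  generalize (p 5).1 - (p 4).1 = y4 at *
  refine mul_ne_zero (mul_ne_zero h2 hB) (mul_ne_zero (mul_ne_zero (mul_ne_zero
    (mul_ne_zero x0 x1) x2) x3) x4) ?_
  -- Put `c i j = y i * y j * polar (l i) (l j)`. The relations give `c 0 2 = -c 0 3 = c 1 3 = -c 1
  -- 4 = c 2 4 = -c 0 2`; the odd cycle of signs leaves `2 * c 0 2 = 0`, whence the need for `2 ≠
  -- 0`.
  linear_combination y0 * y1 * y3 * y4 * R0 - y1 * y3 ^ 2 * y4 * R3 + y1 ^ 2 * y3 * y4 * R1 -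
    y1 * y3 * y4 ^ 2 * R4 + y1 * y2 * y3 * y4 * R2

theorem uniqueWalks_quadrangle : UniqueWalks (incidenceGraph (QuadrangleInc (K := K))) 3 :=
  (uniqueWalks_one.succ noPolygon_quadrangle_two).succ noPolygon_quadrangle_three

theorem uniqueWalks_hexagon (h2 : (2 : K) ≠ 0) :
    UniqueWalks (incidenceGraph (HexagonInc (K := K))) 5 :=
  (((uniqueWalks_one.succ
    (noPolygon_hexagon_of_quadrangle noPolygon_quadrangle_two (by omega))).succ
    (noPolygon_hexagon_of_quadrangle noPolygon_quadrangle_three (by omega))).succ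
    noPolygon_hexagon_four).succ (noPolygon_hexagon_five h2)

variable [Fintype K]

theorem regular_quadrangle :
    Regular (incidenceGraph (QuadrangleInc (K := K))) (Fintype.card K) := by
  refine regular_incidenceGraph
    (fun p b => (b, p.1 * b - p.2.1, p.1 * (p.1 * b - p.2.1) - p.2.2))
    (fun l a => (a, a * l.1 - l.2.1, a * l.2.1 - l.2.2))
    (fun p b b' h => congrArg Prod.fst h) (fun p b b' h => congrArg Prod.fst h) ?_ ?_
  · rintro ⟨a, u, v⟩ ⟨b, m, n⟩
    simp only [QuadrangleInc, Prod.mk.injEq, exists_eq_left]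
    constructor
    · rintro ⟨h1, h2⟩
      obtain rfl : m = a * b - u := by linear_combination h1
      exact ⟨rfl, by linear_combination -h2⟩
    · rintro ⟨rfl, rfl⟩
      constructor <;> ring
  · rintro ⟨a, u, v⟩ ⟨b, m, n⟩
    simp only [QuadrangleInc, Prod.mk.injEq, exists_eq_left]
    constructor
    · rintro ⟨h1, h2⟩
      exact ⟨by linear_combination -h1, by linear_combination -h2⟩
    · rintro ⟨rfl, rfl⟩
      constructor <;> ring

theorem regular_hexagon :
    Regular (incidenceGraph (HexagonInc (K := K))) (Fintype.card K) := by
  refine regular_incidenceGraph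
    (fun p b => (b, p.1 * b - p.2.1, p.1 * (p.1 * b - p.2.1) - p.2.2.1,
      p.1 * (p.1 * (p.1 * b - p.2.1) - p.2.2.1) - p.2.2.2.1,
      p.2.1 * (p.1 * (p.1 * b - p.2.1) - p.2.2.1) - p.2.2.1 * (p.1 * b - p.2.1) - p.2.2.2.2))
    (fun l a => (a, a * l.1 - l.2.1, a * l.2.1 - l.2.2.1, a * l.2.2.1 - l.2.2.2.1,
      (a * l.1 - l.2.1) * l.2.2.1 - (a * l.2.1 - l.2.2.1) * l.2.1 - l.2.2.2.2))
    (fun p b b' h => congrArg Prod.fst h) (fun p b b' h => congrArg Prod.fst h) ?_ ?_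
  · rintro ⟨a, u, v, w, z⟩ ⟨b, m, n, f, k⟩
    simp only [HexagonInc, Prod.mk.injEq, exists_eq_left]
    constructor
    · rintro ⟨h1, h2, h3, h4⟩
      obtain rfl : m = a * b - u := by linear_combination h1
      obtain rfl : n = a * (a * b - u) - v := by linear_combination h2
      exact ⟨rfl, rfl, by linear_combination -h3, by linear_combination -h4⟩
    · rintro ⟨rfl, rfl, rfl, rfl⟩
      refine ⟨?_, ?_, ?_, ?_⟩ <;> ring
  · rintro ⟨a, u, v, w, z⟩ ⟨b, m, n, f, k⟩
    simp only [HexagonInc, Prod.mk.injEq, exists_eq_left]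
    constructor
    · rintro ⟨h1, h2, h3, h4⟩
      obtain rfl : u = a * b - m := by linear_combination h1
      obtain rfl : v = a * m - n := by linear_combination h2
      exact ⟨rfl, rfl, by linear_combination -h3, by linear_combination -h4⟩
    · rintro ⟨rfl, rfl, rfl, rfl⟩
      refine ⟨?_, ?_, ?_, ?_⟩ <;> ring

end Polygons
end FastRobber

/-! ### The two families over prime fields, and the theorem -/

namespace FastRobber

theorem exists_quadrangle_graph (q : ℕ) (hq : q.Prime) :
    ∃ (V : Type) (_ : Fintype V) (_ : Nonempty V) (G : SimpleGraph V),
      Fintype.card V ≤ 2 * q ^ (2 + 1) ∧ Regular G q ∧ UniqueWalks G (2 + 1) := by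
  have : Fact q.Prime := ⟨hq⟩
  refine ⟨_, inferInstance, ⟨.inl 0⟩, incidenceGraph (QuadrangleInc (K := ZMod q)), ?_, ?_,
    uniqueWalks_quadrangle⟩
  · simp only [Fintype.card_sum, Fintype.card_prod, ZMod.card]
    apply le_of_eq
    ring
  · simpa only [ZMod.card] using regular_quadrangle (K := ZMod q)

theorem exists_hexagon_graph (q : ℕ) (hq : q.Prime) (h3 : 3 ≤ q) :
    ∃ (V : Type) (_ : Fintype V) (_ : Nonempty V) (G : SimpleGraph V),
      Fintype.card V ≤ 2 * q ^ (4 + 1) ∧ Regular G q ∧ UniqueWalks G (4 + 1) := by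
  have : Fact q.Prime := ⟨hq⟩
  have h2 : (2 : ZMod q) ≠ 0 := by
    intro h
    have := (ZMod.natCast_eq_zero_iff 2 q).1 (by exact_mod_cast h)
    exact absurd (Nat.le_of_dvd (by omega) this) (by omega)
  refine ⟨_, inferInstance, ⟨.inl 0⟩, incidenceGraph (HexagonInc (K := ZMod q)), ?_, ?_,
    uniqueWalks_hexagon h2⟩
  · simp only [Fintype.card_sum, Fintype.card_prod, ZMod.card]
    apply le_of_eq
    ring
  · simpa only [ZMod.card] using regular_hexagon (K := ZMod q)

end FastRobber

theorem mainTheorem1 (t : ℕ) :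
    (2 ≤ t → ∃ c : ℝ, 0 < c ∧ ∀ n : ℕ, 1 ≤ n →
      ∃ G : SimpleGraph (Fin n), G.Connected ∧
        c * (n : ℝ) ^ ((2 : ℝ) / 3) ≤ (FastRobber.copNumber G t : ℝ)) ∧
    (4 ≤ t → ∃ c : ℝ, 0 < c ∧ ∀ n : ℕ, 1 ≤ n →
      ∃ G : SimpleGraph (Fin n), G.Connected ∧
        c * (n : ℝ) ^ ((4 : ℝ) / 5) ≤ (FastRobber.copNumber G t : ℝ)) := by
  constructor
  · intro ht
    have h := FastRobber.exists_forall_connected_le_copNumber (t := 2) (by omega)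
      (fun q hq _ => FastRobber.exists_quadrangle_graph q hq) ht
    rwa [show ((2 : ℕ) : ℝ) / ((2 : ℕ) + 1) = 2 / 3 by norm_num] at h
  · intro ht
    have h := FastRobber.exists_forall_connected_le_copNumber (t := 4) (by omega)
      FastRobber.exists_hexagon_graph ht
    rwa [show ((4 : ℕ) : ℝ) / ((4 : ℕ) + 1) = 4 / 5 by norm_num] at h
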